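/- Let $H\neq\{0\}$ be a complex separable Hilbert space, let $\mathcal S(H)$ be the convex set of density operators on $H$ (positive trace-class operators of trace $1$), and let $\mathcal P(H)\subseteq\mathcal S(H)$ be the set of pure states, i.e. of the one-dimensional orthogonal projections $|\varphi\rangle\langle\varphi|$, $\|\varphi\|=1$; the elements of $\mathcal S(H)\setminus\mathcal P(H)$ are the mixed states. Equip $\mathcal P(H)$ with the Borel $\sigma$-algebra of the operator-norm topology. For every probability measure $\mu$ on $\mathcal P(H)$ there is exactly one $W_\mu\in\mathcal S(H)$ such that for all bounded self-adjoint operators $A$ on $H$ $$\operatorname{tr}(W_\mu A)=\int_{\mathcal P(H)}\operatorname{tr}(PA)\,\mu(dP)$$ (the integrand being $\mu$-integrable), and the map $R:\mu\mapsto W_\mu$ (the Misra–Bugajski map) has the following properties. (a) $R$ is affine: if $\mu=\alpha\mu_1+(1-\alpha)\mu_2$ with probability measures $\mu,\mu_1,\mu_2$ on $\mathcal P(H)$ and $0\le\alpha\le1$, then $W_\mu=\alpha W_{\mu_1}+(1-\alpha)W_{\mu_2}$. (b) $R$ is surjective onto $\mathcal S(H)$, and it is not injective if $\dim H\ge2$.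 (c) For every probability measure $\mu$ on $\mathcal P(H)$ and every $P\in\mathcal P(H)$, $R(\mu)=P$ holds if and only if $\mu$ is the Dirac measure $\delta_P$. (d) $R$ maps the set of Dirac measures on $\mathcal P(H)$ bijectively onto the set of pure states, and it maps the set of all other probability measures on $\mathcal P(H)$ onto the set of mixed states in a many-to-one way: every mixed state is the image of at least two different probability measures that are not Dirac measures. -/

import Mathlib

open MeasureTheory

noncomputable section

namespace MisraBugajski

variable (H : Type*) [NormedAddCommGroup H] [InnerProductSpace ℂ H] [CompleteSpace H]

/-- The index set of a fixed orthonormal (Hilbert) basis of `H`. -/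
def basisIndex : Set H := (exists_hilbertBasis ℂ H).choose

/-- A fixed orthonormal (Hilbert) basis of `H`. -/
def basis : HilbertBasis (basisIndex H) ℂ H := (exists_hilbertBasis ℂ H).choose_spec.choose

variable {H}

/-- `T` is of trace class: the series `∑ ⟨eᵢ, |T| eᵢ⟩`, where `|T| = (T* T)^(1/2)`, converges.
Its terms are nonnegative, so that its convergence and its value do not depend on the
orthonormal basis. -/
def IsTraceClass (T : H →L[ℂ] H) : Prop :=
  Summable fun i : basisIndex H => (inner ℂ (basis H i) (CFC.abs T (basis H i))).re

/-- The trace `∑ ⟨eᵢ, T eᵢ⟩`. For a trace-class operator the series converges absolutely, and its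
value does not depend on the orthonormal basis. -/
def trace (T : H →L[ℂ] H) : ℂ :=
  ∑' i : basisIndex H, inner ℂ (basis H i) (T (basis H i))

variable (H)

/-- Density operators: positive trace-class operators of trace `1`. -/
abbrev DensityOperator : Type _ :=
  {W : H →L[ℂ] H // W.IsPositive ∧ IsTraceClass W ∧ trace W = 1}

/-- The projective Hilbert space, as the set of all one-dimensional orthogonal projections
`|φ⟩⟨φ|`, `‖φ‖ = 1`. As a subtype of `H →L[ℂ] H` it carries the topology of the operator norm
and the σ-algebra of the Borel sets of that topology. -/
abbrev ProjectiveHilbert : Type _ :=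
  {P : H →L[ℂ] H // ∃ φ : H, ‖φ‖ = 1 ∧ P = InnerProductSpace.rankOne ℂ φ φ}

/-- The σ-algebra on the projective Hilbert space is the Borel σ-algebra of its topology. -/
theorem borelSpace_projectiveHilbert (E : Type*) [NormedAddCommGroup E] [InnerProductSpace ℂ E] :
    BorelSpace (ProjectiveHilbert E) := inferInstance

variable {H}

/-- `W` represents the probability measure `μ` on the projective Hilbert space:
for every bounded self-adjoint operator `A`, the function `P ↦ tr (P A)` is `μ`-integrable
and `tr (W A) = ∫ tr (P A) μ(dP)`. -/
def Represents (μ : ProbabilityMeasure (ProjectiveHilbert H)) (W : DensityOperator H) : Prop :=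
  ∀ A : H →L[ℂ] H, IsSelfAdjoint A →
    Integrable (fun P : ProjectiveHilbert H => trace (P.1 ∘L A))
      (μ : Measure (ProjectiveHilbert H)) ∧
    trace (W.1 ∘L A) =
      ∫ P : ProjectiveHilbert H, trace (P.1 ∘L A) ∂(μ : Measure (ProjectiveHilbert H))

/-- `W` is a pure state: a one-dimensional orthogonal projection. -/
def IsPure (W : DensityOperator H) : Prop := ∃ P : ProjectiveHilbert H, W.1 = P.1

/-- `μ` is the Dirac measure of some point of the projective Hilbert space. -/
def IsDirac (μ : ProbabilityMeasure (ProjectiveHilbert H)) : Prop :=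
  ∃ P : ProjectiveHilbert H, μ = diracProba P

end MisraBugajski

end

/-!
The operator `W_μ` is the barycenter `∫ P μ(dP)`, a Bochner integral in the operator norm; it exists
because the projective space of a separable `H` is second countable and all its points have norm
one. For `P = |φ⟩⟨φ|`, Bessel's inequality for `φ` and `A* φ` bounds the partial sums of the trace
series of `P A` uniformly in `P` (`norm_sum_inner_le`), so dominated convergence interchanges trace
and integral and gives `tr (W_μ A) = ∫ tr (P A) μ(dP)` (`trace_barycenter_comp`). The operators
`A = |x⟩⟨x|` show that this formula determines `W_μ` (`Represents.unique`).

If `W_μ = P` is pure, then the transition probability `tr (Q P) ≤ 1` integrates to `tr (P²) = 1`, so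
by the equality case of the Cauchy–Schwarz inequality `μ`-almost every `Q` equals `P`
(`eq_diracProba_of_misraBugajski_eq`).

Surjectivity needs no spectral theorem: if `S` is self-adjoint with `S² = T`, where `T` is positive
of finite trace, then `T = ∑ |S eᵢ⟩⟨S eᵢ|`, so `T` is the barycenter of a sum of point masses
`‖S eᵢ‖²` (`exists_measure_barycenter_eq`). For a density operator `W = S²` and a unit vector `x`
the operator `W - |S x⟩⟨S x|` is still positive, so `W` is also the barycenter of a probability
measure having an atom at the line of `S x` (`exists_misraBugajski_eq_of_sq_eq`). If `W` is mixed,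
its rank is at least two and these lines are uncountably many; since one probability measure has
only countably many atoms, at least two measures have the barycenter `W`
(`nontrivial_fiber_of_not_isPure`).
-/

namespace MisraBugajski

open InnerProductSpace Filter Topology
open scoped ComplexOrder InnerProduct

/-! ### Trace, rank-one projections and lines -/

section Trace

variable {H : Type*} [NormedAddCommGroup H] [InnerProductSpace ℂ H] [CompleteSpace H]

instance countable_basisIndex [TopologicalSpace.SeparableSpace H] : Countable (basisIndex H) := by
  -- Distinct basis vectors have distance `√2`, so the balls of radius `1 / 2` are disjoint.
  have h : (Set.univ : Set (basisIndex H)).PairwiseDisjoint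
      fun i => Metric.ball (basis H i) (1 / 2) := by
    intro i _ j _ hij
    refine Metric.ball_disjoint_ball ?_
    have h2 := @norm_sub_sq ℂ H _ _ _ (basis H i) (basis H j)
    rw [(basis H).orthonormal.2 hij, (basis H).orthonormal.1, (basis H).orthonormal.1] at h2
    rw [dist_eq_norm]
    norm_num at h2 ⊢
    nlinarith [norm_nonneg (basis H i - basis H j)]
  exact Set.countable_univ_iff.1 (h.countable_of_isOpen (fun _ _ => Metric.isOpen_ball)
    fun i _ => ⟨basis H i, Metric.mem_ball_self (by norm_num)⟩)

theorem hasSum_trace_rankOne (x y : H) :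
    HasSum (fun i => inner ℂ (basis H i) (rankOne ℂ x y (basis H i))) (inner ℂ y x) := by
  refine ((basis H).hasSum_inner_mul_inner y x).congr_fun ?_
  intro i
  simp

theorem trace_rankOne (x y : H) : trace (rankOne ℂ x y) = inner ℂ y x :=
  (hasSum_trace_rankOne x y).tsum_eq

theorem trace_comp_rankOne (T : H →L[ℂ] H) (x y : H) :
    trace (T ∘L rankOne ℂ x y) = inner ℂ y (T x) := by
  rw [comp_rankOne, trace_rankOne]

theorem hasSum_trace_comp (P : ProjectiveHilbert H) (A : H →L[ℂ] H) :
    HasSum (fun i => inner ℂ (basis H i) (P.1 (A (basis H i)))) (trace (P.1 ∘L A)) := by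
  obtain ⟨_, φ, -, rfl⟩ := P
  have := hasSum_trace_rankOne φ (A.adjoint φ)
  rw [← rankOne_comp] at this
  exact this.summable.hasSum

theorem trace_projectiveHilbert (P : ProjectiveHilbert H) : trace P.1 = 1 := by
  obtain ⟨_, φ, h, rfl⟩ := P
  simp [trace_rankOne, h]

/-- Bessel's inequality for `φ` and `A* φ` bounds the partial sums of `tr (P A)` uniformly in
`P = |φ⟩⟨φ|`. -/
theorem norm_sum_inner_le (P : ProjectiveHilbert H) (A : H →L[ℂ] H) (s : Finset (basisIndex H)) :
    ‖∑ i ∈ s, inner ℂ (basis H i) (P.1 (A (basis H i)))‖ ≤ (1 + ‖A‖ ^ 2) / 2 := by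
  obtain ⟨_, φ, hφ, rfl⟩ := P
  have h1 := (basis H).orthonormal.sum_inner_products_le (s := s) φ
  have h2 := (basis H).orthonormal.sum_inner_products_le (s := s) (A.adjoint φ)
  have h3 : ‖A.adjoint φ‖ ≤ ‖A‖ := by
    simpa [hφ] using A.adjoint.le_opNorm φ
  have h4 : ‖A.adjoint φ‖ ^ 2 ≤ ‖A‖ ^ 2 := by gcongr
  calc _ ≤ ∑ i ∈ s, ‖inner ℂ (basis H i) (rankOne ℂ φ φ (A (basis H i)))‖ := norm_sum_le _ _
    _ ≤ ∑ i ∈ s, (‖inner ℂ (basis H i) φ‖ ^ 2 + ‖inner ℂ (basis H i) (A.adjoint φ)‖ ^ 2) / 2 := by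
      refine Finset.sum_le_sum fun i _ => ?_
      rw [rankOne_apply, inner_smul_right, norm_mul, ← A.adjoint_inner_left,
        norm_inner_symm (A.adjoint φ)]
      nlinarith [sq_nonneg (‖inner ℂ (basis H i) φ‖ - ‖inner ℂ (basis H i) (A.adjoint φ)‖)]
    _ ≤ _ := by
      rw [← Finset.sum_div, Finset.sum_add_distrib]
      rw [hφ] at h1
      linarith

omit [CompleteSpace H] in
theorem isPositive_projectiveHilbert (P : ProjectiveHilbert H) : P.1.IsPositive := by
  obtain ⟨_, φ, -, rfl⟩ := P
  exact isPositive_rankOne_self φ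

omit [CompleteSpace H] in
theorem norm_projectiveHilbert (P : ProjectiveHilbert H) : ‖P.1‖ = 1 := by
  obtain ⟨_, φ, h, rfl⟩ := P
  simp [h]

/-- A positive operator equals its absolute value, so that being of trace class is just the
convergence of its trace series. -/
theorem isTraceClass_of_isPositive {T : H →L[ℂ] H} (hT : T.IsPositive)
    (hs : Summable fun i => inner ℂ (basis H i) (T (basis H i))) : IsTraceClass T := by
  rw [IsTraceClass, CFC.abs_of_nonneg T ((ContinuousLinearMap.nonneg_iff_isPositive T).2 hT)]
  exact (Complex.hasSum_re hs.hasSum).summable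

/-- A density operator has a convergent trace series with sum `1`. -/
theorem hasSum_densityOperator (W : DensityOperator H) :
    HasSum (fun i => (inner ℂ (basis H i) (W.1 (basis H i))).re) 1 := by
  obtain ⟨W, -, -, hW⟩ := W
  have hs : Summable fun i => inner ℂ (basis H i) (W (basis H i)) := by
    by_contra h
    -- A divergent series would have the junk value `0` as its sum.
    simp [trace, tsum_eq_zero_of_not_summable h] at hW
  have := Complex.hasSum_re hs.hasSum
  rw [trace] at hW
  rwa [hW] at this

/-- If every value of the density operator `W` lies on the line of `a`, then `W` is pure. -/
theorem isPure_of_range_subset_line (W : DensityOperator H) {a : H} (ha : ‖a‖ = 1)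
    (h : ∀ y, ∃ c : ℂ, W.1 y = c • a) : IsPure W := by
  have hsa := W.2.1.isSelfAdjoint
  have h1 : ∀ y, W.1 y = inner ℂ a (W.1 y) • a := fun y => by
    obtain ⟨c, hc⟩ := h y
    simp [hc, ha]
  obtain ⟨c, hc⟩ := h a
  have h2 : W.1 = rankOne ℂ ((starRingEnd ℂ c) • a) a := by
    ext y
    rw [h1 y, ← ContinuousLinearMap.adjoint_inner_left, hsa.adjoint_eq, hc]
    simp [inner_smul_left, smul_smul, mul_comm]
  have h3 : starRingEnd ℂ c = 1 := by
    have := W.2.2.2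
    rwa [h2, trace_rankOne, inner_smul_right, inner_self_eq_norm_sq_to_K, ha, RCLike.ofReal_one,
      one_pow, mul_one] at this
  exact ⟨⟨_, a, ha, rfl⟩, by rw [h2, h3, one_smul]⟩

/-- The transition probability `tr (QP) = |⟨ψ, φ⟩|²` of `P = |φ⟩⟨φ|` and `Q = |ψ⟩⟨ψ|` is a real number
at most `1`, with equality only for `Q = P`. -/
theorem exists_trace_comp_eq (P Q : ProjectiveHilbert H) : ∃ r : ℝ, trace (Q.1 ∘L P.1) = r ∧
    r ≤ 1 ∧ (r = 1 → Q = P) := by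
  obtain ⟨_, φ, hφ, rfl⟩ := P
  obtain ⟨_, ψ, hψ, rfl⟩ := Q
  refine ⟨‖inner ℂ ψ φ‖ ^ 2, ?_, ?_, fun h => ?_⟩
  · rw [trace_comp_rankOne, rankOne_apply, inner_smul_right, ← inner_conj_symm φ ψ, RCLike.mul_conj]
    norm_cast
  · have := norm_inner_le_norm (𝕜 := ℂ) ψ φ
    rw [hφ, hψ] at this
    exact pow_le_one₀ (norm_nonneg _) (by linarith)
  · have h1 : ‖inner ℂ φ ψ‖ = ‖φ‖ * ‖ψ‖ := by
      rw [hφ, hψ, norm_inner_symm]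
      nlinarith [norm_nonneg (inner ℂ ψ φ)]
    obtain ⟨r, -, rfl⟩ := (norm_inner_eq_norm_iff (𝕜 := ℂ) (by rintro rfl; simp at hφ)
      (by rintro rfl; simp at hψ)).1 h1
    have hr : ‖r‖ = 1 := by simpa [norm_smul, hφ] using hψ
    have hr' : r * starRingEnd ℂ r = 1 := by simp [RCLike.mul_conj, hr]
    ext z
    simp [smul_smul, hr']

theorem exists_line [Nontrivial H] (x : H) :
    ∃ P : ProjectiveHilbert H, (‖x‖ ^ 2 : ℝ) • P.1 = rankOne ℂ x x := by
  by_cases hx : x = 0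
  · obtain ⟨φ, hφ⟩ := exists_norm_eq H zero_le_one
    exact ⟨⟨_, φ, hφ, rfl⟩, by simp [hx]⟩
  · have hx' : ‖x‖ ≠ 0 := norm_ne_zero_iff.2 hx
    refine ⟨⟨_, ((‖x‖⁻¹ : ℝ) : ℂ) • x, by simp [norm_smul, hx'], rfl⟩, ?_⟩
    ext z
    have : (‖x‖ : ℂ) ≠ 0 := by exact_mod_cast hx'
    simp [smul_smul, ← Complex.coe_smul]
    congr 1
    field_simp

/-- The projection onto the line of `x`; an arbitrary point of the projective space for `x = 0`. -/
noncomputable def line [Nontrivial H] (x : H) : ProjectiveHilbert H := (exists_line x).choose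

theorem line_spec [Nontrivial H] (x : H) : (‖x‖ ^ 2 : ℝ) • (line x).1 = rankOne ℂ x x :=
  (exists_line x).choose_spec

theorem exists_eq_smul_of_line_eq [Nontrivial H] {x y : H} (hx : x ≠ 0) (hy : y ≠ 0)
    (h : line x = line y) : ∃ k : ℂ, x = k • y := by
  have hx' : ‖x‖ ^ 2 ≠ 0 := pow_ne_zero _ (norm_ne_zero_iff.2 hx)
  have hy' : ‖y‖ ^ 2 ≠ 0 := pow_ne_zero _ (norm_ne_zero_iff.2 hy)
  have h1 : (‖y‖ ^ 2 : ℝ) • rankOne ℂ x x = (‖x‖ ^ 2 : ℝ) • rankOne ℂ y y := by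
    rw [← line_spec x, ← line_spec y, h, smul_comm]
  have h2 := congrArg (fun T : H →L[ℂ] H => T x) h1
  simp only [smul_apply, rankOne_apply, inner_self_eq_norm_sq_to_K] at h2
  have hc : (‖y‖ : ℂ) ^ 2 * (‖x‖ : ℂ) ^ 2 ≠ 0 := by exact_mod_cast mul_ne_zero hy' hx'
  refine ⟨((‖y‖ : ℂ) ^ 2 * (‖x‖ : ℂ) ^ 2)⁻¹ * ((‖x‖ : ℂ) ^ 2 * inner ℂ y x), ?_⟩
  rw [mul_smul, eq_inv_smul_iff₀ hc]
  simpa [← Complex.coe_smul, smul_smul] using h2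

theorem exists_isSelfAdjoint_sq_eq {T : H →L[ℂ] H} (hT : T.IsPositive) :
    ∃ S : H →L[ℂ] H, IsSelfAdjoint S ∧ S * S = T := by
  have hT' := (ContinuousLinearMap.nonneg_iff_isPositive T).2 hT
  exact ⟨CFC.sqrt T, (CFC.sqrt_nonneg T).isSelfAdjoint, CFC.sqrt_mul_sqrt_self T hT'⟩

theorem inner_sq_apply {S : H →L[ℂ] H} (hS : IsSelfAdjoint S) (x y : H) :
    inner ℂ x ((S * S) y) = inner ℂ (S x) (S y) := by
  rw [← hS.adjoint_eq, ContinuousLinearMap.adjoint_inner_left, hS.adjoint_eq]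
  rfl

/-- By the Cauchy–Schwarz inequality, splitting off `|S x⟩⟨S x|` from `S²`, for a unit vector `x`,
leaves a positive operator. -/
theorem isPositive_sq_sub_rankOne {S : H →L[ℂ] H} (hS : IsSelfAdjoint S) {x : H} (hx : ‖x‖ = 1) :
    (S * S - rankOne ℂ (S x) (S x)).IsPositive := by
  rw [ContinuousLinearMap.isPositive_def']
  refine ⟨?_, fun y => ?_⟩
  · refine .sub ?_ (isPositive_rankOne_self (S x)).isSelfAdjoint
    rw [IsSelfAdjoint, star_mul, hS.star_eq]
  · have h : (inner ℂ ((S * S - rankOne ℂ (S x) (S x)) y) y) =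
        ((‖S y‖ ^ 2 - ‖inner ℂ (S x) y‖ ^ 2 : ℝ) : ℂ) := by
      rw [sub_apply, inner_sub_left, ← inner_conj_symm, inner_sq_apply hS,
        inner_self_eq_norm_sq_to_K, rankOne_apply, inner_smul_left, RCLike.conj_mul]
      simp
    have h1 : inner ℂ (S x) y = inner ℂ x (S y) := hS.isSymmetric x y
    have h2 := norm_inner_le_norm (𝕜 := ℂ) x (S y)
    rw [hx, one_mul] at h2
    rw [ContinuousLinearMap.reApplyInnerSelf_apply, h, h1]
    refine (sub_nonneg.2 ?_).trans_eq (Complex.ofReal_re _).symm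
    gcongr

end Trace

/-! ### Barycenters of measures on the projective space -/

section Barycenter

variable {H : Type*} [NormedAddCommGroup H] [InnerProductSpace ℂ H]
  [TopologicalSpace.SeparableSpace H]

/-- The projective space is a continuous image of the unit sphere. -/
instance secondCountableTopology_projectiveHilbert :
    SecondCountableTopology (ProjectiveHilbert H) := by
  let f : Metric.sphere (0 : H) 1 → ProjectiveHilbert H := fun φ =>
    ⟨rankOne ℂ φ.1 φ.1, φ.1, by simp, rfl⟩
  have hf : Continuous f := by
    refine Continuous.subtype_mk ?_ _
    exact ((ContinuousLinearMap.smulRightL ℂ H H).continuous.comp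
      ((innerSL ℂ).continuous.comp continuous_subtype_val)).clm_apply continuous_subtype_val
  have : SecondCountableTopology H := UniformSpace.secondCountable_of_separable H
  have hs : Function.Surjective f := by
    rintro ⟨_, φ, hφ, rfl⟩
    exact ⟨⟨φ, by simpa using hφ⟩, rfl⟩
  have : TopologicalSpace.SeparableSpace (ProjectiveHilbert H) := hs.denseRange.separableSpace hf
  exact UniformSpace.secondCountable_of_separable _

theorem integrable_val (μ : Measure (ProjectiveHilbert H)) [IsFiniteMeasure μ] :
    Integrable (fun P : ProjectiveHilbert H => P.1) μ :=
  Integrable.of_bound continuous_subtype_val.aestronglyMeasurable 1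
    (ae_of_all _ fun P => (norm_projectiveHilbert P).le)

/-- The barycenter `∫ P μ(dP)`, as a Bochner integral in the operator norm. The integral converges
for every finite measure `μ`, by `integrable_val`. -/
noncomputable def barycenter (μ : Measure (ProjectiveHilbert H)) : H →L[ℂ] H := ∫ P, P.1 ∂μ

variable [CompleteSpace H]

theorem integral_inner (μ : Measure (ProjectiveHilbert H)) [IsFiniteMeasure μ] (x y : H) :
    ∫ P, inner ℂ x (P.1 y) ∂μ = inner ℂ x (barycenter μ y) := by
  have h := ((innerSL ℂ x) ∘L (ContinuousLinearMap.apply ℂ H y)).integral_comp_comm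
    (integrable_val μ)
  exact h

omit [TopologicalSpace.SeparableSpace H] in
theorem isPositive_barycenter (μ : Measure (ProjectiveHilbert H)) [IsFiniteMeasure μ] :
    (barycenter μ).IsPositive := by
  rw [← ContinuousLinearMap.nonneg_iff_isPositive]
  exact integral_nonneg fun P =>
    (ContinuousLinearMap.nonneg_iff_isPositive P.1).2 (isPositive_projectiveHilbert P)

theorem integrable_trace_comp (μ : Measure (ProjectiveHilbert H)) [IsFiniteMeasure μ]
    (A : H →L[ℂ] H) : Integrable (fun P : ProjectiveHilbert H => trace (P.1 ∘L A)) μ := by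
  refine Integrable.of_bound (C := (1 + ‖A‖ ^ 2) / 2) ?_ (ae_of_all _ fun P =>
    le_of_tendsto' (hasSum_trace_comp P A).norm fun s => norm_sum_inner_le P A s)
  refine aestronglyMeasurable_of_tendsto_ae atTop
    (f := fun (s : Finset (basisIndex H)) (P : ProjectiveHilbert H) =>
      ∑ i ∈ s, inner ℂ (basis H i) (P.1 (A (basis H i)))) (fun s => ?_)
    (ae_of_all _ fun P => hasSum_trace_comp P A)
  exact (by fun_prop : Continuous fun P : ProjectiveHilbert H =>
    ∑ i ∈ s, inner ℂ (basis H i) (P.1 (A (basis H i)))).aestronglyMeasurable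

theorem hasSum_barycenter (μ : Measure (ProjectiveHilbert H)) [IsFiniteMeasure μ]
    (A : H →L[ℂ] H) :
    HasSum (fun i => inner ℂ (basis H i) (barycenter μ (A (basis H i))))
      (∫ P, trace (P.1 ∘L A) ∂μ) := by
  have hc : ∀ i, Continuous fun P : ProjectiveHilbert H =>
      inner ℂ (basis H i) (P.1 (A (basis H i))) := fun i => by fun_prop
  have hi : ∀ i, Integrable (fun P : ProjectiveHilbert H =>
      inner ℂ (basis H i) (P.1 (A (basis H i)))) μ := fun i =>
    ((innerSL ℂ (basis H i)) ∘L (ContinuousLinearMap.apply ℂ H (A (basis H i)))).integrable_comp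
      (integrable_val μ)
  have := tendsto_integral_filter_of_norm_le_const (μ := μ) (l := atTop)
    (F := fun (s : Finset (basisIndex H)) (P : ProjectiveHilbert H) =>
      ∑ i ∈ s, inner ℂ (basis H i) (P.1 (A (basis H i))))
    (f := fun P => trace (P.1 ∘L A))
    (Eventually.of_forall fun s =>
      (continuous_finsetSum s fun i _ => hc i).aestronglyMeasurable)
    ⟨(1 + ‖A‖ ^ 2) / 2, Eventually.of_forall fun s => ae_of_all _ fun P =>
      norm_sum_inner_le P A s⟩
    (ae_of_all _ fun P => hasSum_trace_comp P A)
  refine this.congr fun s => ?_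
  rw [integral_finsetSum _ fun i _ => hi i]
  exact Finset.sum_congr rfl fun i _ => integral_inner μ _ _

theorem trace_barycenter_comp (μ : Measure (ProjectiveHilbert H)) [IsFiniteMeasure μ]
    (A : H →L[ℂ] H) : trace (barycenter μ ∘L A) = ∫ P, trace (P.1 ∘L A) ∂μ :=
  (hasSum_barycenter μ A).tsum_eq

end Barycenter

/-! ### The Misra–Bugajski map -/

section Map

variable {H : Type*} [NormedAddCommGroup H] [InnerProductSpace ℂ H] [CompleteSpace H]
  [TopologicalSpace.SeparableSpace H]

/-- The Misra–Bugajski map, sending a probability measure to its barycenter. -/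
noncomputable def misraBugajski (μ : ProbabilityMeasure (ProjectiveHilbert H)) :
    DensityOperator H :=
  have h := hasSum_barycenter (μ : Measure (ProjectiveHilbert H)) 1
  ⟨barycenter (μ : Measure (ProjectiveHilbert H)), isPositive_barycenter _,
    isTraceClass_of_isPositive (isPositive_barycenter _) h.summable, by
      refine h.tsum_eq.trans ?_
      simp only [ContinuousLinearMap.one_def, ContinuousLinearMap.comp_id, trace_projectiveHilbert]
      simp⟩

theorem misraBugajski_represents (μ : ProbabilityMeasure (ProjectiveHilbert H)) :
    Represents μ (misraBugajski μ) :=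
  fun A _ => ⟨integrable_trace_comp _ A, trace_barycenter_comp _ A⟩

omit [TopologicalSpace.SeparableSpace H] in
/-- Testing against the operators `|x⟩⟨x|` recovers the quadratic form `⟨x, W x⟩`, hence `W`. -/
theorem Represents.unique {μ : ProbabilityMeasure (ProjectiveHilbert H)} {W W' : DensityOperator H}
    (h : Represents μ W) (h' : Represents μ W') : W = W' := by
  refine Subtype.ext (ContinuousLinearMap.coe_injective ((ext_inner_map _ _).1 fun x => ?_))
  have hx : IsSelfAdjoint (rankOne ℂ x x) := (isPositive_rankOne_self x).isSelfAdjoint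
  have := (h _ hx).2.trans (h' _ hx).2.symm
  rw [trace_comp_rankOne, trace_comp_rankOne] at this
  change inner ℂ (W.1 x) x = inner ℂ (W'.1 x) x
  rw [← inner_conj_symm, this, inner_conj_symm]

theorem misraBugajski_eq_iff {μ : ProbabilityMeasure (ProjectiveHilbert H)}
    {W : DensityOperator H} : misraBugajski μ = W ↔ Represents μ W :=
  ⟨fun h => h ▸ misraBugajski_represents μ, fun h => (misraBugajski_represents μ).unique h⟩

theorem misraBugajski_affine (μ μ₁ μ₂ : ProbabilityMeasure (ProjectiveHilbert H)) (α : ℝ)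
    (h0 : 0 ≤ α) (h1 : α ≤ 1)
    (h : (μ : Measure (ProjectiveHilbert H)) =
      ENNReal.ofReal α • (μ₁ : Measure (ProjectiveHilbert H)) +
      ENNReal.ofReal (1 - α) • (μ₂ : Measure (ProjectiveHilbert H))) :
    (misraBugajski μ).1 =
      (α : ℂ) • (misraBugajski μ₁).1 + ((1 - α : ℝ) : ℂ) • (misraBugajski μ₂).1 := by
  change barycenter _ = (α : ℂ) • barycenter _ + ((1 - α : ℝ) : ℂ) • barycenter _
  rw [barycenter, h, integral_add_measure ((integrable_val _).smul_measure ENNReal.ofReal_ne_top)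
    ((integrable_val _).smul_measure ENNReal.ofReal_ne_top), integral_smul_measure,
    integral_smul_measure, ENNReal.toReal_ofReal h0, ENNReal.toReal_ofReal (sub_nonneg.2 h1),
    Complex.coe_smul, Complex.coe_smul]
  rfl

theorem misraBugajski_diracProba (P : ProjectiveHilbert H) :
    (misraBugajski (diracProba P)).1 = P.1 :=
  integral_dirac (fun Q : ProjectiveHilbert H => Q.1) P

/-- If the barycenter is `P`, the transition probability `tr (QP) ≤ 1` has integral
`tr (P²) = 1`, so that it equals `1`, i.e. `Q = P`, for almost every `Q`. -/
theorem eq_diracProba_of_misraBugajski_eq {μ : ProbabilityMeasure (ProjectiveHilbert H)}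
    {P : ProjectiveHilbert H} (h : (misraBugajski μ).1 = P.1) : μ = diracProba P := by
  obtain ⟨hi, ht⟩ := misraBugajski_represents μ P.1 (isPositive_projectiveHilbert P).isSelfAdjoint
  choose r hr hr1 hreq using exists_trace_comp_eq P
  have hPP : trace (P.1 ∘L P.1) = 1 := by
    obtain ⟨_, φ, hφ, rfl⟩ := P
    simp [trace_comp_rankOne, hφ]
  simp only [hr] at hi ht
  rw [h, hPP, integral_complex_ofReal, ← Complex.ofReal_one] at ht
  have hi' : Integrable r (μ : Measure (ProjectiveHilbert H)) := by simpa using hi.re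
  have ht' : ∫ Q, (1 - r Q) ∂(μ : Measure (ProjectiveHilbert H)) = 0 := by
    rw [integral_sub (integrable_const _) hi', ← Complex.ofReal_inj.1 ht]
    simp
  have hae := (integral_eq_zero_iff_of_nonneg (fun Q => sub_nonneg.2 (hr1 Q))
    ((integrable_const _).sub hi')).1 ht'
  have hae' : ∀ᵐ Q ∂(μ : Measure (ProjectiveHilbert H)), Q = P :=
    hae.mono fun Q hQ => hreq Q (sub_eq_zero.1 hQ).symm
  refine Subtype.ext (Measure.ext fun s hs => ?_)
  change (μ : Measure (ProjectiveHilbert H)) s = Measure.dirac P s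
  rw [Measure.dirac_apply' _ hs]
  by_cases hP : P ∈ s
  · rw [Set.indicator_of_mem hP, Pi.one_apply, prob_compl_eq_zero_iff hs |>.symm]
    exact hae'.mono fun Q hQ => show Q ∈ s from hQ ▸ hP
  · rw [Set.indicator_of_notMem hP]
    exact measure_mono_null (fun Q hQ (hQP : Q = P) => hP (hQP ▸ hQ)) hae'

theorem misraBugajski_eq_val_iff {μ : ProbabilityMeasure (ProjectiveHilbert H)}
    {P : ProjectiveHilbert H} : (misraBugajski μ).1 = P.1 ↔ μ = diracProba P :=
  ⟨eq_diracProba_of_misraBugajski_eq, fun h => h ▸ misraBugajski_diracProba P⟩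

theorem isDirac_iff_isPure {μ : ProbabilityMeasure (ProjectiveHilbert H)} :
    IsDirac μ ↔ IsPure (misraBugajski μ) :=
  exists_congr fun _ => misraBugajski_eq_val_iff.symm

end Map

/-! ### Surjectivity and the fibers over mixed states -/

section Surjective

variable {H : Type*} [NormedAddCommGroup H] [InnerProductSpace ℂ H] [CompleteSpace H]
  [TopologicalSpace.SeparableSpace H] [Nontrivial H]

/-- With `S² = T`, the operator `T = ∑ |S eᵢ⟩⟨S eᵢ|` is the barycenter of the measure with mass
`‖S eᵢ‖²` at the line of `S eᵢ`. -/
theorem exists_measure_barycenter_eq {T : H →L[ℂ] H} (hT : T.IsPositive) {c : ℝ}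
    (hc : HasSum (fun i => (inner ℂ (basis H i) (T (basis H i))).re) c) :
    ∃ ν : Measure (ProjectiveHilbert H), ν Set.univ = ENNReal.ofReal c ∧ barycenter ν = T := by
  obtain ⟨S, hS, rfl⟩ := exists_isSelfAdjoint_sq_eq hT
  have hc' : HasSum (fun i => ‖S (basis H i)‖ ^ 2) c := by
    refine hc.congr_fun fun i => ?_
    rw [inner_sq_apply hS, inner_self_eq_norm_sq_to_K]
    norm_cast
  let ν : Measure (ProjectiveHilbert H) := Measure.sum fun i =>
    ENNReal.ofReal (‖S (basis H i)‖ ^ 2) • Measure.dirac (line (S (basis H i)))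
  have hν : ν Set.univ = ENNReal.ofReal c := by
    rw [Measure.sum_apply _ MeasurableSet.univ, ← hc'.tsum_eq,
      ENNReal.ofReal_tsum_of_nonneg (fun i => by positivity) hc'.summable]
    simp
  have : IsFiniteMeasure ν := ⟨by simp [hν]⟩
  refine ⟨ν, hν, ?_⟩
  have h := hasSum_integral_measure (integrable_val ν)
  simp only [integral_smul_measure, integral_dirac, ENNReal.toReal_ofReal (sq_nonneg _),
    line_spec] at h
  ext y
  refine ext_inner_left ℂ fun x => ?_
  have h1 := ((innerSL ℂ x) ∘L (ContinuousLinearMap.apply ℂ H y)).hasSum h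
  have h2 := (basis H).hasSum_inner_mul_inner (S x) (S y)
  rw [inner_sq_apply hS]
  refine HasSum.unique h1 (h2.congr_fun fun i => ?_)
  have h3 := hS.isSymmetric x (basis H i)
  have h4 := hS.isSymmetric (basis H i) y
  simp only [ContinuousLinearMap.coe_coe] at h3 h4
  simp [h3, h4, mul_comm]

/-- Every density operator `W = S²` is the barycenter of a probability measure that has an atom
at the line of `S x`, for any given unit vector `x` with `S x ≠ 0`. -/
theorem exists_misraBugajski_eq_of_sq_eq {S : H →L[ℂ] H} (hS : IsSelfAdjoint S)
    {W : DensityOperator H} (hW : S * S = W.1) {x : H} (hx : ‖x‖ = 1) :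
    ∃ μ : ProbabilityMeasure (ProjectiveHilbert H), misraBugajski μ = W ∧
      (S x ≠ 0 → 0 < (μ : Measure (ProjectiveHilbert H)) {line (S x)}) := by
  have h1 := Complex.hasSum_re (hasSum_trace_rankOne (S x) (S x))
  have hre : (inner ℂ (S x) (S x)).re = ‖S x‖ ^ 2 := by
    rw [inner_self_eq_norm_sq_to_K]
    norm_cast
  rw [hre] at h1
  have h2 := (hasSum_densityOperator W).sub h1
  have hpos := isPositive_sq_sub_rankOne hS hx
  have h3 : HasSum (fun i => (inner ℂ (basis H i)
      ((S * S - rankOne ℂ (S x) (S x)) (basis H i))).re) (1 - ‖S x‖ ^ 2) := by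
    refine h2.congr_fun fun i => ?_
    rw [hW, sub_apply, inner_sub_right, Complex.sub_re]
  have hle : ‖S x‖ ^ 2 ≤ 1 := sub_nonneg.1 (h3.nonneg fun i => hpos.re_inner_nonneg_right _)
  obtain ⟨ν, hν, hb⟩ := exists_measure_barycenter_eq hpos h3
  have : IsFiniteMeasure ν := ⟨by simp [hν]⟩
  let m : Measure (ProjectiveHilbert H) :=
    ENNReal.ofReal (‖S x‖ ^ 2) • Measure.dirac (line (S x)) + ν
  have hm : IsProbabilityMeasure m := ⟨by
    simp only [m, Measure.add_apply, Measure.smul_apply, measure_univ, smul_eq_mul, mul_one, hν]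
    rw [← ENNReal.ofReal_add (by positivity) (sub_nonneg.2 hle)]
    simp⟩
  refine ⟨⟨m, hm⟩, Subtype.ext ?_, fun hSx => ?_⟩
  · change barycenter m = W.1
    have hd : Integrable (fun P : ProjectiveHilbert H => P.1)
        (ENNReal.ofReal (‖S x‖ ^ 2) • Measure.dirac (line (S x))) :=
      (integrable_val _).smul_measure ENNReal.ofReal_ne_top
    rw [barycenter, integral_add_measure hd (integrable_val ν), integral_smul_measure,
      integral_dirac, ENNReal.toReal_ofReal (by positivity), line_spec,
      show ∫ P, P.1 ∂ν = _ from hb, hW]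
    abel
  · change 0 < m _
    have : 0 < ‖S x‖ₑ ^ 2 := ENNReal.pow_pos (enorm_pos.2 hSx) 2
    simp [m, this]

theorem misraBugajski_surjective : Function.Surjective (misraBugajski (H := H)) := by
  intro W
  obtain ⟨S, hS, hW⟩ := exists_isSelfAdjoint_sq_eq W.2.1
  obtain ⟨x, hx⟩ := exists_norm_eq H zero_le_one
  obtain ⟨μ, hμ, -⟩ := exists_misraBugajski_eq_of_sq_eq hS hW hx
  exact ⟨μ, hμ⟩

omit [TopologicalSpace.SeparableSpace H] [Nontrivial H] in
theorem exists_linearIndependent_of_not_isPure {W : DensityOperator H} (hW : ¬ IsPure W) :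
    ∃ u v : H, LinearIndependent ℂ ![W.1 u, W.1 v] := by
  have h0 : ∃ u, W.1 u ≠ 0 := by
    by_contra! h
    have h' : HasSum (fun _ : basisIndex H => (0 : ℝ)) 1 := by
      simpa [h] using hasSum_densityOperator W
    exact one_ne_zero (h'.unique hasSum_zero)
  obtain ⟨u, hu⟩ := h0
  by_contra! h
  refine hW (isPure_of_range_subset_line W (norm_smul_inv_norm (𝕜 := ℂ) hu) fun y => ?_)
  have := h u y
  rw [LinearIndependent.pair_iff' hu, not_forall_not] at this
  obtain ⟨c, hc⟩ := this
  refine ⟨c * ‖W.1 u‖, ?_⟩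
  have : (‖W.1 u‖ : ℂ) ≠ 0 := by simpa using hu
  rw [smul_smul, ← hc, mul_assoc]
  simp [this]

/-- For `W u`, `W v` linearly independent, the lines of `S (u + t v)`, `t` real, are uncountably
many, while a single probability measure has only countably many atoms. -/
theorem nontrivial_fiber_of_not_isPure {W : DensityOperator H} (hW : ¬ IsPure W) :
    {μ | ¬ IsDirac μ ∧ misraBugajski μ = W}.Nontrivial := by
  obtain ⟨S, hS, hSW⟩ := exists_isSelfAdjoint_sq_eq W.2.1
  obtain ⟨u, v, huv⟩ := exists_linearIndependent_of_not_isPure hW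
  have hSS : ∀ y, W.1 y = S (S y) := fun y => by rw [← hSW]; rfl
  rw [hSS, hSS, LinearIndependent.pair_iff] at huv
  have hne : ∀ t : ℝ, S (u + (t : ℂ) • v) ≠ 0 := fun t ht => by
    -- A relation `S (u + t v) = 0` would give `W u + t W v = 0` after one more application of `S`.
    have := huv 1 t (by simpa using congrArg S ht)
    exact one_ne_zero this.1
  have hne' : ∀ t : ℝ, u + (t : ℂ) • v ≠ 0 := fun t ht => hne t (by rw [ht, map_zero])
  let x : ℝ → H := fun t => ((‖u + (t : ℂ) • v‖ : ℂ)⁻¹) • (u + (t : ℂ) • v)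
  have hxn : ∀ t, ‖x t‖ = 1 := fun t => norm_smul_inv_norm (hne' t)
  have hSx : ∀ t, S (x t) ≠ 0 := fun t => by
    rw [map_smul]
    exact smul_ne_zero (by simpa using hne' t) (hne t)
  have hinj : Function.Injective fun t => line (S (x t)) := fun t s hts => by
    obtain ⟨k, hk⟩ := exists_eq_smul_of_line_eq (hSx t) (hSx s) hts
    have ha : ((‖u + (t : ℂ) • v‖ : ℂ)⁻¹) ≠ 0 := by simpa using hne' t
    simp only [x] at hk
    set a := ((‖u + (t : ℂ) • v‖ : ℂ)⁻¹)
    set b := ((‖u + (s : ℂ) • v‖ : ℂ)⁻¹)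
    have h1 := huv (a - k * b) (a * t - k * b * s) (by
      have := congrArg S hk
      simp only [map_smul, map_add] at this
      linear_combination (norm := module) this)
    have h2 : a * ((t : ℂ) - s) = 0 := by linear_combination h1.2 - s * h1.1
    exact_mod_cast sub_eq_zero.1 ((mul_eq_zero.1 h2).resolve_left ha)
  choose μ hμ hatom using fun t => exists_misraBugajski_eq_of_sq_eq hS hSW (hxn t)
  have hmem : ∀ t, μ t ∈ {μ | ¬ IsDirac μ ∧ misraBugajski μ = W} := fun t =>
    ⟨by rwa [isDirac_iff_isPure, hμ], hμ t⟩
  by_contra hcon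
  rw [Set.not_nontrivial_iff] at hcon
  have hcount := Measure.countable_meas_pos_of_disjoint_iUnion
    (μ := (μ 0 : Measure (ProjectiveHilbert H))) (As := fun t : ℝ => {line (S (x t))})
    (fun t => measurableSet_singleton _)
    fun t s hts => Set.disjoint_singleton.2 fun h => hts (hinj h)
  refine Set.not_countable_univ (α := ℝ) (hcount.mono fun t _ => ?_)
  change 0 < (μ 0 : Measure (ProjectiveHilbert H)) _
  rw [hcon (hmem 0) (hmem t)]
  exact hatom t (hSx t)

omit [TopologicalSpace.SeparableSpace H] in
theorem exists_ne_projectiveHilbert (h : 2 ≤ Module.rank ℂ H) :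
    ∃ P Q : ProjectiveHilbert H, P ≠ Q := by
  obtain ⟨u, hu⟩ := exists_ne (0 : H)
  obtain ⟨v, hv⟩ : ∃ v, LinearIndependent ℂ ![u, v] := by
    by_contra! hcon
    have : Module.rank ℂ H ≤ 1 := rank_le_one_iff.2 ⟨u, fun v => by
      have := hcon v
      rwa [LinearIndependent.pair_iff' hu, not_forall_not] at this⟩
    exact absurd (h.trans this) (by norm_num)
  refine ⟨line u, line v, fun huv => ?_⟩
  obtain ⟨k, hk⟩ := exists_eq_smul_of_line_eq hu (hv.ne_zero 1) huv
  have := LinearIndependent.pair_iff.1 hv 1 (-k) (by simpa [sub_eq_zero, ← sub_eq_add_neg] using hk)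
  exact one_ne_zero this.1

/-- The even mixture of two distinct points is not a Dirac measure, and its image is mixed. -/
theorem exists_not_isPure (h : 2 ≤ Module.rank ℂ H) : ∃ W : DensityOperator H, ¬ IsPure W := by
  obtain ⟨P, Q, hPQ⟩ := exists_ne_projectiveHilbert h
  let m : Measure (ProjectiveHilbert H) :=
    (2⁻¹ : ENNReal) • Measure.dirac P + (2⁻¹ : ENNReal) • Measure.dirac Q
  have hm : IsProbabilityMeasure m := ⟨by simp [m, ENNReal.inv_two_add_inv_two]⟩
  refine ⟨misraBugajski ⟨m, hm⟩, fun hp => ?_⟩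
  obtain ⟨X, hX⟩ := isDirac_iff_isPure.2 hp
  have hX' : m = Measure.dirac X := congrArg Subtype.val hX
  have hP : m {P} = Measure.dirac X {P} := by rw [hX']
  have hQ : m {Q} = Measure.dirac X {Q} := by rw [hX']
  by_cases hXP : X = P
  · subst hXP
    simp [m, hPQ] at hQ
  · simp [m, hPQ.symm, hXP] at hP

end Surjective

end MisraBugajski

theorem mainTheorem4 {H : Type*} [NormedAddCommGroup H] [InnerProductSpace ℂ H] [CompleteSpace H]
    [TopologicalSpace.SeparableSpace H] [Nontrivial H] :
    ∃ R : ProbabilityMeasure (MisraBugajski.ProjectiveHilbert H) → MisraBugajski.DensityOperator H,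
      -- `R μ` is the unique density operator representing `μ`
      (∀ μ W, R μ = W ↔ MisraBugajski.Represents μ W) ∧
      -- (a) `R` is affine
      (∀ (μ μ₁ μ₂ : ProbabilityMeasure (MisraBugajski.ProjectiveHilbert H)) (α : ℝ),
        0 ≤ α → α ≤ 1 →
        (μ : Measure (MisraBugajski.ProjectiveHilbert H)) =
          ENNReal.ofReal α • (μ₁ : Measure (MisraBugajski.ProjectiveHilbert H)) +
          ENNReal.ofReal (1 - α) • (μ₂ : Measure (MisraBugajski.ProjectiveHilbert H)) →
        (R μ).1 = (α : ℂ) • (R μ₁).1 + ((1 - α : ℝ) : ℂ) • (R μ₂).1) ∧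
      -- (b) `R` is surjective, and not injective if `dim H ≥ 2`
      Function.Surjective R ∧
      (2 ≤ Module.rank ℂ H → ¬ Function.Injective R) ∧
      -- (c) the only measure mapped to a pure state `P` is the Dirac measure at `P`
      (∀ (μ : ProbabilityMeasure (MisraBugajski.ProjectiveHilbert H))
        (P : MisraBugajski.ProjectiveHilbert H), (R μ).1 = P.1 ↔ μ = diracProba P) ∧
      -- (d) the Dirac measures correspond bijectively to the pure states; all other measures are
      -- mapped onto the mixed states, each of which is the image of several such measures
      Set.BijOn R {μ | MisraBugajski.IsDirac μ} {W | MisraBugajski.IsPure W} ∧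
      R '' {μ | ¬ MisraBugajski.IsDirac μ} = {W | ¬ MisraBugajski.IsPure W} ∧
      (∀ W, ¬ MisraBugajski.IsPure W →
        {μ | ¬ MisraBugajski.IsDirac μ ∧ R μ = W}.Nontrivial) := by
  refine ⟨MisraBugajski.misraBugajski, fun μ W => MisraBugajski.misraBugajski_eq_iff,
    MisraBugajski.misraBugajski_affine, MisraBugajski.misraBugajski_surjective, fun h hinj => ?_,
    fun μ P => MisraBugajski.misraBugajski_eq_val_iff, ⟨?_, ?_, ?_⟩, ?_,
    fun W => MisraBugajski.nontrivial_fiber_of_not_isPure⟩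
  · obtain ⟨W, hW⟩ := MisraBugajski.exists_not_isPure h
    obtain ⟨μ, hμ, ν, hν, hne⟩ := MisraBugajski.nontrivial_fiber_of_not_isPure hW
    exact hne (hinj (hμ.2.trans hν.2.symm))
  · exact fun μ hμ => MisraBugajski.isDirac_iff_isPure.1 hμ
  · rintro _ ⟨P, rfl⟩ μ ⟨Q, rfl⟩ h
    refine (MisraBugajski.misraBugajski_eq_val_iff.1 ?_).symm
    rw [← h, MisraBugajski.misraBugajski_diracProba]
  · rintro W ⟨P, hP⟩
    exact ⟨diracProba P, ⟨P, rfl⟩,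
      Subtype.ext ((MisraBugajski.misraBugajski_diracProba P).trans hP.symm)⟩
  · ext W
    constructor
    · rintro ⟨μ, hμ, rfl⟩
      exact fun h => hμ (MisraBugajski.isDirac_iff_isPure.2 h)
    · intro hW
      obtain ⟨μ, rfl⟩ := MisraBugajski.misraBugajski_surjective W
      exact ⟨μ, fun h => hW (MisraBugajski.isDirac_iff_isPure.1 h), rfl⟩
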